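/- Let $S$ be a set of $n$ points in general position in the plane, meaning that no three points of $S$ are collinear and no four points of $S$ are cocircular. For $j\ge 0$ let $e_j$ be the number of (oriented) $j$-edges of $S$, that is, of directed straight lines $\ell$ passing through two points of $S$ such that the open half-plane bounded by $\ell$ and on the right of $\ell$ contains exactly $j$ points of $S$. Put $E_{\le k}=\sum_{j=0}^{k}e_j$ and $$p_E(z)=\sum_{k=0}^{n-3}E_{\le k}\,z^k$$ (with $p_E=0$ if $n\le 2$). Let $\overline{cr}(S)$ be the number of pairwise edge crossings of the complete graph with vertex set $S$ drawn with straight-line segments, i.e. the number of unordered pairs of distinct segments spanned by $S$ that have a common interior point. Then \begin{enumerate} \item $p_E(1)=3\binom{n}{3}$; \item $p_E'(1)=9\binom{n}{4}-\overline{cr}(S)$; \item $p_E''(1)=35\binom{n}{5}-(n-4)\,\overline{cr}(S)$; \item $p_E(-1)=\dfrac{n(n-1)}{2}$ if $n$ is odd. \end{enumerate} -/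

import Mathlib

namespace EdgePoly

/-- The Euclidean plane. -/
abbrev Plane : Type := EuclideanSpace ℝ (Fin 2)

/-- No three points of `S` are collinear and no four points of `S` are cocircular. -/
def GeneralPosition (S : Finset Plane) : Prop :=
  (∀ T ⊆ S, T.card = 3 → ¬ Collinear ℝ (T : Set Plane)) ∧
  (∀ T ⊆ S, T.card = 4 → ¬ EuclideanGeometry.Cospherical (T : Set Plane))

/-- `r` lies in the open half-plane to the right of the line through `p` and `q`,
directed from `p` to `q`. -/
def IsRightOf (p q r : Plane) : Prop :=
  (q 0 - p 0) * (r 1 - p 1) - (q 1 - p 1) * (r 0 - p 0) < 0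

open Classical in
/-- The number `e_j` of (oriented) `j`-edges of `S`. When no three points of `S` are collinear,
the directed lines through two points of `S` correspond bijectively to the ordered pairs of
distinct points of `S`. -/
noncomputable def numEdges (S : Finset Plane) (j : ℕ) : ℕ :=
  (S.offDiag.filter fun pq => (S.filter fun r => IsRightOf pq.1 pq.2 r).card = j).card

/-- The number `E_{≤ k} = ∑_{j=0}^{k} e_j` of `(≤ k)`-edges of `S`. -/
noncomputable def numAtMostEdges (S : Finset Plane) (k : ℕ) : ℕ :=
  ∑ j ∈ Finset.range (k + 1), numEdges S j

/-- The polynomial `p_E(z) = ∑_{k=0}^{n-3} E_{≤ k} z^k`, where `n` is the number of points of `S`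
(the sum is empty for `n ≤ 2`). -/
noncomputable def edgePolynomial (S : Finset Plane) : Polynomial ℂ :=
  ∑ k ∈ Finset.range (S.card - 2),
    Polynomial.C (numAtMostEdges S k : ℂ) * Polynomial.X ^ k

open Classical in
/-- The number of pairwise edge crossings of the complete graph drawn with straight-line segments
on the vertex set `S`: the number of unordered pairs of distinct edges (an edge being a two-element
subset of `S`) whose segments have a common interior point. -/
noncomputable def crossingNumber (S : Finset Plane) : ℕ :=
  (((S.powersetCard 2).powersetCard 2).filter fun P => ∃ a b c d : Plane,
    P = {{a, b}, {c, d}} ∧ (openSegment ℝ a b ∩ openSegment ℝ c d).Nonempty).card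

end EdgePoly

namespace EdgePoly

/-! Exchanging sums, an ordered pair with `r` points on its right contributes `∑ z^k` over `r ≤ k ≤
n-3` to `p_E(z)` (`sum_numAtMostEdges_mul`). At `z = 1` the value and first two derivatives are thus
combinations of the moments of `r` of degree at most 3; at `z = -1` only `∑ (-1)^r` matters.
Reversing a line replaces `r` by `n-2-r`. This yields the first moment, reduces the third to the
lower ones, and makes `∑ (-1)^r` vanish for odd `n`. The second moment carries the geometry
(`sum_sq_sub`). Left count minus right count is a sum of orientations, so its square expands over
pairs of further points into a sum over quadruples of `sidePair`. Sign identities on four points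
turn that sum into the number of ordered crossing quadruples (`quadSum_crosses`), which is 8 times
the crossing number. -/

open Finset

/-! ### Orientations of triples -/

/-- Twice the signed area of the triangle `p q r`. -/
noncomputable def det (p q r : Plane) : ℝ :=
  (q 0 - p 0) * (r 1 - p 1) - (q 1 - p 1) * (r 0 - p 0)

/-- The orientation of the triangle `p q r`, as an integer in `{-1, 0, 1}`. -/
noncomputable def orient (p q r : Plane) : ℤ := (SignType.sign (det p q r) : SignType)

lemma isRightOf_iff (p q r : Plane) : IsRightOf p q r ↔ det p q r < 0 := Iff.rfl

lemma det_swap_left (p q r : Plane) : det q p r = -det p q r := by simp only [det]; ring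

lemma det_rotate (p q r : Plane) : det q r p = det p q r := by simp only [det]; ring

lemma det_self_left (p r : Plane) : det p p r = 0 := by simp only [det]; ring

lemma det_self_right (p q : Plane) : det p q q = 0 := by simp only [det]; ring

lemma det_self_outer (p q : Plane) : det p q p = 0 := by simp only [det]; ring

lemma det_four (p q r s : Plane) : det p q r - det p q s + det p r s - det q r s = 0 := by
  simp only [det]; ring

lemma orient_of_pos {p q r : Plane} (h : 0 < det p q r) : orient p q r = 1 := by
  simp [orient, sign_pos h]

lemma orient_of_neg {p q r : Plane} (h : det p q r < 0) : orient p q r = -1 := by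
  simp [orient, sign_neg h]

lemma orient_of_zero {p q r : Plane} (h : det p q r = 0) : orient p q r = 0 := by
  simp [orient, h]

lemma orient_swap_left (p q r : Plane) : orient q p r = -orient p q r := by
  simp only [orient, det_swap_left p q r, Left.sign_neg, SignType.coe_neg]

lemma orient_rotate (p q r : Plane) : orient q r p = orient p q r := by
  simp only [orient, det_rotate p q r]

lemma orient_self_left (p r : Plane) : orient p p r = 0 := orient_of_zero (det_self_left p r)

lemma orient_self_right (p q : Plane) : orient p q q = 0 := orient_of_zero (det_self_right p q)

lemma orient_self_outer (p q : Plane) : orient p q p = 0 := orient_of_zero (det_self_outer p q)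

lemma ext_coords {p q : Plane} (h0 : p 0 = q 0) (h1 : p 1 = q 1) : p = q := by
  ext i; fin_cases i <;> assumption

lemma collinear_of_det_eq_zero {p q r : Plane} (hpq : p ≠ q) (h : det p q r = 0) :
    Collinear ℝ ({p, q, r} : Set Plane) := by
  rw [collinear_iff_of_mem (p₀ := p) (by simp)]
  refine ⟨q - p, ?_⟩
  have key : ∃ t : ℝ, r = t • (q - p) +ᵥ p := by
    simp only [det] at h
    by_cases h0 : q 0 - p 0 = 0
    · have h1 : q 1 - p 1 ≠ 0 := fun h1 => hpq (ext_coords (by linarith) (by linarith))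
      refine ⟨(r 1 - p 1) / (q 1 - p 1), ext_coords ?_ ?_⟩
      · rw [h0] at h
        have : r 0 - p 0 = 0 := by
          have : (q 1 - p 1) * (r 0 - p 0) = 0 := by linarith
          exact (mul_eq_zero.1 this).resolve_left h1
        simp [h0]; linarith
      · simp [div_mul_cancel₀ _ h1]
    · refine ⟨(r 0 - p 0) / (q 0 - p 0), ext_coords ?_ ?_⟩
      · simp [div_mul_cancel₀ _ h0]
      · simp only [vadd_eq_add, PiLp.add_apply, PiLp.smul_apply, PiLp.sub_apply, smul_eq_mul]
        field_simp
        linarith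
  intro x hx
  simp only [Set.mem_insert_iff, Set.mem_singleton_iff] at hx
  rcases hx with rfl | rfl | rfl
  · exact ⟨0, by simp⟩
  · exact ⟨1, by simp⟩
  · exact key

lemma GeneralPosition.det_ne_zero {S : Finset Plane} (hS : GeneralPosition S) {p q r : Plane}
    (hp : p ∈ S) (hq : q ∈ S) (hr : r ∈ S) (hpq : p ≠ q) (hpr : p ≠ r) (hqr : q ≠ r) :
    det p q r ≠ 0 := by
  classical
  intro h
  refine hS.1 {p, q, r} ?_ (card_eq_three.2 ⟨p, q, r, hpq, hpr, hqr, rfl⟩) ?_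
  · intro x hx
    simp only [mem_insert, mem_singleton] at hx
    rcases hx with rfl | rfl | rfl <;> assumption
  · simpa using collinear_of_det_eq_zero hpq h

/-! ### Crossing segments through orientations -/

/-- The segments `p q` and `r s` separate each other's endpoints. -/
def Crosses (p q r s : Plane) : Prop :=
  det p q r * det p q s < 0 ∧ det r s p * det r s q < 0

lemma Crosses.ne {p q r s : Plane} (h : Crosses p q r s) :
    p ≠ q ∧ p ≠ r ∧ p ≠ s ∧ q ≠ r ∧ q ≠ s ∧ r ≠ s := by
  obtain ⟨h1, h2⟩ := h
  refine ⟨?_, ?_, ?_, ?_, ?_, ?_⟩ <;> rintro rfl <;>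
    simp [det_self_left, det_self_right, det_self_outer] at h1 h2

lemma Crosses.swap_left {p q r s : Plane} (h : Crosses p q r s) : Crosses q p r s := by
  refine ⟨?_, ?_⟩
  · rw [det_swap_left p q, det_swap_left p q, neg_mul_neg]; exact h.1
  · rw [mul_comm]; exact h.2

lemma Crosses.symm {p q r s : Plane} (h : Crosses p q r s) : Crosses r s p q := ⟨h.2, h.1⟩

lemma Crosses.swap_right {p q r s : Plane} (h : Crosses p q r s) : Crosses p q s r :=
  h.symm.swap_left.symm

lemma Crosses.nonempty {p q r s : Plane} (h : Crosses p q r s) :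
    (openSegment ℝ p q ∩ openSegment ℝ r s).Nonempty := by
  have aux : ∀ x y : ℝ, x * y < 0 → x - y ≠ 0 ∧ 0 < x / (x - y) ∧ 0 < -y / (x - y) := by
    intro x y hxy
    rcases mul_neg_iff.1 hxy with ⟨hx, hy⟩ | ⟨hx, hy⟩
    · exact ⟨by linarith, div_pos hx (by linarith), div_pos (by linarith) (by linarith)⟩
    · exact ⟨by linarith, div_pos_of_neg_of_neg hx (by linarith),
        div_pos_of_neg_of_neg (by linarith) (by linarith)⟩
  obtain ⟨hu, hu1, hu2⟩ := aux _ _ h.1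
  obtain ⟨ht, ht1, ht2⟩ := aux _ _ h.2
  -- The point where the affine function `det r s` vanishes on the segment `p q`; the second set of
  -- weights comes likewise from `det p q` on `r s`.
  refine ⟨(-det r s q / (det r s p - det r s q)) • p + (det r s p / (det r s p - det r s q)) • q,
    ⟨_, _, ht2, ht1, by field_simp; ring, rfl⟩,
    ⟨-det p q s / (det p q r - det p q s), det p q r / (det p q r - det p q s),
      hu2, hu1, by field_simp; ring, ext_coords ?_ ?_⟩⟩ <;>
  · simp only [PiLp.add_apply, PiLp.smul_apply, smul_eq_mul]
    field_simp
    simp only [det]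
    ring

/-- The affine function `det p q` vanishes at the common point, which is a convex combination of `r`
and `s` with positive weights. -/
lemma det_mul_neg_of_nonempty {p q r s : Plane}
    (h : (openSegment ℝ p q ∩ openSegment ℝ r s).Nonempty) :
    det p q r * det p q s < 0 ∨ (det p q r = 0 ∧ det p q s = 0) := by
  obtain ⟨x, ⟨a, b, ha, hb, hab, rfl⟩, ⟨c, d, hc, hd, hcd, h⟩⟩ := h
  have h0 := congrArg (fun z : Plane => z 0) h
  have h1 := congrArg (fun z : Plane => z 1) h
  simp only [PiLp.add_apply, PiLp.smul_apply, smul_eq_mul] at h0 h1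
  have key : c * det p q r + d * det p q s = 0 := by
    obtain rfl : a = 1 - b := by linarith
    obtain rfl : c = 1 - d := by linarith
    simp only [det]
    linear_combination (q 0 - p 0) * h1 - (q 1 - p 1) * h0
  by_cases hr : det p q r = 0
  · right
    rw [hr] at key
    refine ⟨hr, ?_⟩
    have : d * det p q s = 0 := by linarith
    exact (mul_eq_zero.1 this).resolve_left hd.ne'
  · left
    have hs : d * (det p q r * det p q s) = - (c * det p q r ^ 2) := by
      linear_combination det p q r * key
    have : 0 < c * det p q r ^ 2 := by positivity
    by_contra hneg
    have := mul_nonneg hd.le (not_lt.1 hneg)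
    linarith

lemma GeneralPosition.nonempty_inter_iff {S : Finset Plane} (hS : GeneralPosition S)
    {p q r s : Plane} (hp : p ∈ S) (hq : q ∈ S) (hr : r ∈ S) (hs : s ∈ S) (hpq : p ≠ q)
    (hrs : r ≠ s) (hne : ({p, q} : Set Plane) ≠ {r, s}) :
    (openSegment ℝ p q ∩ openSegment ℝ r s).Nonempty ↔ Crosses p q r s := by
  have aux : ∀ {p q r : Plane}, p ∈ S → q ∈ S → r ∈ S → p ≠ q → det p q r = 0 → r = p ∨ r = q := by
    intro p q r hp hq hr hpq h
    by_contra! hc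
    exact hS.det_ne_zero hp hq hr hpq hc.1.symm hc.2.symm h
  refine ⟨fun h => ⟨?_, ?_⟩, Crosses.nonempty⟩
  · refine (det_mul_neg_of_nonempty h).resolve_right fun h0 => hne ?_
    rcases aux hp hq hr hpq h0.1 with rfl | rfl <;> rcases aux hp hq hs hpq h0.2 with rfl | rfl
    all_goals first | exact absurd rfl hrs | rfl | exact Set.pair_comm _ _
  · rw [Set.inter_comm] at h
    refine (det_mul_neg_of_nonempty h).resolve_right fun h0 => hne ?_
    rcases aux hr hs hp hrs h0.1 with rfl | rfl <;> rcases aux hr hs hq hrs h0.2 with rfl | rfl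
    all_goals first | exact absurd rfl hpq | rfl | exact Set.pair_comm _ _

/-! ### Sign identities on four points -/

open Classical in
/-- The product of the orientations of `p q r` and `p q s`, for `r ≠ s`. -/
noncomputable def sidePair (p q r s : Plane) : ℤ :=
  if r = s then 0 else orient p q r * orient p q s

/-- The product of the orientations of the four triangles spanned by `p, q, r, s`. -/
noncomputable def orientProd (p q r s : Plane) : ℤ :=
  orient p q r * orient p q s * orient p r s * orient q r s

lemma orient_swap_right (p q r : Plane) : orient p r q = -orient p q r := by
  rw [orient_swap_left r p q, ← orient_rotate r p q]

/-- `orientProd` is 1 in convex position, -1 if one point lies inside the triangle of the others, 0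
if two points coincide. Hull edges contribute 1 and the other edges -1: 4 - 2 = 2 in the convex
case, 3 - 3 = 0 in the other. -/
lemma GeneralPosition.sum_sidePair_eq {S : Finset Plane} (hS : GeneralPosition S)
    {p q r s : Plane} (hp : p ∈ S) (hq : q ∈ S) (hr : r ∈ S) (hs : s ∈ S) :
    sidePair p q r s + sidePair p r q s + sidePair p s q r + sidePair q r p s + sidePair q s p r
      + sidePair r s p q = orientProd p q r s ^ 2 + orientProd p q r s := by
  by_cases hd : p ≠ q ∧ p ≠ r ∧ p ≠ s ∧ q ≠ r ∧ q ≠ s ∧ r ≠ s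
  · obtain ⟨hpq, hpr, hps, hqr, hqs, hrs⟩ := hd
    simp only [sidePair, orientProd, hpq, hpr, hps, hqr, hqs, hrs, if_false, orient_rotate p q r,
      orient_rotate p q s, orient_rotate p r s, orient_rotate q r s, orient_swap_right p q r,
      orient_swap_right p q s, orient_swap_right p r s, orient_swap_right q r s]
    have h4 := det_four p q r s
    rcases (hS.det_ne_zero hp hq hr hpq hpr hqr).lt_or_gt with hA | hA <;>
    rcases (hS.det_ne_zero hp hq hs hpq hps hqs).lt_or_gt with hB | hB <;>
    rcases (hS.det_ne_zero hp hr hs hpr hps hrs).lt_or_gt with hC | hC <;>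
    rcases (hS.det_ne_zero hq hr hs hqr hqs hrs).lt_or_gt with hD | hD <;>
    first
    -- The relation `h4` excludes the two sign patterns that no four points realise.
    | (exfalso; linarith)
    | simp [orient_of_pos, orient_of_neg, hA, hB, hC, hD]
  · have : p = q ∨ p = r ∨ p = s ∨ q = r ∨ q = s ∨ r = s := by tauto
    rcases this with rfl | rfl | rfl | rfl | rfl | rfl <;>
      simp [sidePair, orientProd, orient_self_left, orient_self_right, orient_self_outer]

-- Two segments cross exactly when both `sidePair` terms are -1, which forces `orientProd` to be 1
-- and the right side to be 4; in every other case it cancels to 0.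
open Classical in
lemma GeneralPosition.four_mul_crosses {S : Finset Plane} (hS : GeneralPosition S)
    {p q r s : Plane} (hp : p ∈ S) (hq : q ∈ S) (hr : r ∈ S) (hs : s ∈ S) :
    4 * (if Crosses p q r s then 1 else 0 : ℤ) =
      orientProd p q r s ^ 2 - sidePair p q r s - sidePair r s p q + orientProd p q r s := by
  by_cases hd : p ≠ q ∧ p ≠ r ∧ p ≠ s ∧ q ≠ r ∧ q ≠ s ∧ r ≠ s
  · obtain ⟨hpq, hpr, hps, hqr, hqs, hrs⟩ := hd
    simp only [sidePair, orientProd, hpq, hrs, if_false, orient_rotate p r s, orient_rotate q r s, Crosses,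
      det_rotate p r s, det_rotate q r s]
    rcases (hS.det_ne_zero hp hq hr hpq hpr hqr).lt_or_gt with hA | hA <;>
    rcases (hS.det_ne_zero hp hq hs hpq hps hqs).lt_or_gt with hB | hB <;>
    rcases (hS.det_ne_zero hp hr hs hpr hps hrs).lt_or_gt with hC | hC <;>
    rcases (hS.det_ne_zero hq hr hs hqr hqs hrs).lt_or_gt with hD | hD <;>
    simp [orient_of_pos, orient_of_neg, hA, hB, hC, hD, mul_neg_iff,
      hA.not_gt, hB.not_gt, hC.not_gt, hD.not_gt]
  · rw [if_neg fun h => hd h.ne]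
    have : p = q ∨ p = r ∨ p = s ∨ q = r ∨ q = s ∨ r = s := by tauto
    rcases this with rfl | rfl | rfl | rfl | rfl | rfl <;>
      simp [sidePair, orientProd, orient_self_left, orient_self_right, orient_self_outer]

/-! ### Summation over quadruples -/

/-- The sum of `f` over all quadruples of points of `S`. -/
noncomputable def quadSum (S : Finset Plane) (f : Plane → Plane → Plane → Plane → ℤ) : ℤ :=
  ∑ p ∈ S, ∑ q ∈ S, ∑ r ∈ S, ∑ s ∈ S, f p q r s

lemma quadSum_swap₁₂ (S : Finset Plane) (f : Plane → Plane → Plane → Plane → ℤ) :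
    quadSum S (fun p q r s => f q p r s) = quadSum S f := sum_comm

lemma quadSum_swap₂₃ (S : Finset Plane) (f : Plane → Plane → Plane → Plane → ℤ) :
    quadSum S (fun p q r s => f p r q s) = quadSum S f :=
  sum_congr rfl fun _ _ => sum_comm

lemma quadSum_swap₃₄ (S : Finset Plane) (f : Plane → Plane → Plane → Plane → ℤ) :
    quadSum S (fun p q r s => f p q s r) = quadSum S f :=
  sum_congr rfl fun _ _ => sum_congr rfl fun _ _ => sum_comm

lemma quadSum_congr {S : Finset Plane} {f g : Plane → Plane → Plane → Plane → ℤ}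
    (h : ∀ p ∈ S, ∀ q ∈ S, ∀ r ∈ S, ∀ s ∈ S, f p q r s = g p q r s) :
    quadSum S f = quadSum S g :=
  sum_congr rfl fun p hp => sum_congr rfl fun q hq => sum_congr rfl fun r hr =>
    sum_congr rfl fun s hs => h p hp q hq r hr s hs

-- All relabelings of `sidePair` have the same total `Σ`. With `Q` the total of `orientProd ^ 2 +
-- orientProd` and `X` that of the crossings, the two identities read `6Σ = Q` and `4X = Q - 2Σ`,
-- hence `X = Σ`.
open Classical in
lemma GeneralPosition.quadSum_crosses {S : Finset Plane} (hS : GeneralPosition S) :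
    quadSum S (fun p q r s => if Crosses p q r s then 1 else 0) = quadSum S sidePair := by
  have e1 := quadSum_swap₂₃ S sidePair
  have e2 : quadSum S (fun p q r s => sidePair p s q r) = quadSum S sidePair := by
    rw [quadSum_swap₃₄ S (fun p q r s => sidePair p r q s), e1]
  have e3 : quadSum S (fun p q r s => sidePair q r p s) = quadSum S sidePair := by
    rw [quadSum_swap₁₂ S (fun p q r s => sidePair p r q s), e1]
  have e4 : quadSum S (fun p q r s => sidePair q s p r) = quadSum S sidePair := by
    rw [quadSum_swap₃₄ S (fun p q r s => sidePair q r p s), e3]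
  have e5 : quadSum S (fun p q r s => sidePair r s p q) = quadSum S sidePair := by
    rw [quadSum_swap₂₃ S (fun p q r s => sidePair q s p r), e4]
  have h1 := quadSum_congr fun p hp q hq r hr s hs => hS.sum_sidePair_eq (p := p) (q := q)
    (r := r) (s := s) hp hq hr hs
  have h2 := quadSum_congr fun p hp q hq r hr s hs => hS.four_mul_crosses (p := p) (q := q)
    (r := r) (s := s) hp hq hr hs
  simp only [quadSum, sum_add_distrib, sum_sub_distrib, ← mul_sum] at h1 h2 e1 e2 e3 e4 e5 ⊢
  linarith

/-! ### Crossing pairs of edges against crossing quadruples -/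

open Classical in
lemma GeneralPosition.crosses_of_mem {S : Finset Plane} (hS : GeneralPosition S)
    {a b c d : Plane} (hP : ({{a, b}, {c, d}} : Finset (Finset Plane)) ∈
      (S.powersetCard 2).powersetCard 2)
    (h : (openSegment ℝ a b ∩ openSegment ℝ c d).Nonempty) :
    (a ∈ S ∧ b ∈ S ∧ c ∈ S ∧ d ∈ S) ∧ Crosses a b c d := by
  obtain ⟨hsub, hcard⟩ := mem_powersetCard.1 hP
  obtain ⟨hab, hab'⟩ := mem_powersetCard.1 (hsub (mem_insert_self _ _))
  obtain ⟨hcd, hcd'⟩ := mem_powersetCard.1 (hsub (mem_insert_of_mem (mem_singleton_self _)))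
  have ha := hab (mem_insert_self a {b})
  have hb := hab (mem_insert_of_mem (mem_singleton_self b))
  have hc := hcd (mem_insert_self c {d})
  have hd := hcd (mem_insert_of_mem (mem_singleton_self d))
  refine ⟨⟨ha, hb, hc, hd⟩, (hS.nonempty_inter_iff ha hb hc hd ?_ ?_ ?_).1 h⟩
  · rintro rfl; simp at hab'
  · rintro rfl; simp at hcd'
  · intro heq
    have : ({a, b} : Finset Plane) = {c, d} := by
      apply coe_injective; simpa using heq
    simp [this] at hcard

open Classical in
lemma Crosses.mem_powersetCard {S : Finset Plane} {p q r s : Plane} (h : Crosses p q r s)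
    (hp : p ∈ S) (hq : q ∈ S) (hr : r ∈ S) (hs : s ∈ S) :
    ({{p, q}, {r, s}} : Finset (Finset Plane)) ∈ (S.powersetCard 2).powersetCard 2 := by
  obtain ⟨hpq, hpr, hps, hqr, hqs, hrs⟩ := h.ne
  rw [Finset.mem_powersetCard]
  refine ⟨?_, card_pair fun heq => ?_⟩
  · intro T hT
    simp only [mem_insert, mem_singleton] at hT
    rw [Finset.mem_powersetCard]
    rcases hT with rfl | rfl
    · exact ⟨by simp [insert_subset_iff, hp, hq], card_pair hpq⟩
    · exact ⟨by simp [insert_subset_iff, hr, hs], card_pair hrs⟩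
  · have : p ∈ ({r, s} : Finset Plane) := heq ▸ mem_insert_self p {q}
    simp [hpr, hps] at this

lemma finset_pair_eq_pair_iff {α : Type*} [DecidableEq α] {x y z w : α} :
    ({x, y} : Finset α) = {z, w} ↔ x = z ∧ y = w ∨ x = w ∧ y = z := by
  rw [← coe_inj, coe_pair, coe_pair, Set.pair_eq_pair_iff]

open Classical in
/-- A pair of crossing edges is described by exactly eight quadruples of endpoints. -/
lemma Crosses.card_fiber {S : Finset Plane} {a b c d : Plane} (h : Crosses a b c d)
    (ha : a ∈ S) (hb : b ∈ S) (hc : c ∈ S) (hd : d ∈ S) :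
    ((((S ×ˢ S) ×ˢ (S ×ˢ S)).filter fun x => Crosses x.1.1 x.1.2 x.2.1 x.2.2).filter
      fun x => ({{x.1.1, x.1.2}, {x.2.1, x.2.2}} : Finset (Finset Plane)) =
        {{a, b}, {c, d}}).card = 8 := by
  obtain ⟨hab, hac, had, hbc, hbd, hcd⟩ := h.ne
  have : (((S ×ˢ S) ×ˢ (S ×ˢ S)).filter fun x => Crosses x.1.1 x.1.2 x.2.1 x.2.2).filter
      (fun x => ({{x.1.1, x.1.2}, {x.2.1, x.2.2}} : Finset (Finset Plane)) =
        {{a, b}, {c, d}}) =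
      -- Reversing either edge and exchanging the two edges gives 2 · 2 · 2 quadruples.
      {((a, b), (c, d)), ((b, a), (c, d)), ((a, b), (d, c)), ((b, a), (d, c)),
        ((c, d), (a, b)), ((c, d), (b, a)), ((d, c), (a, b)), ((d, c), (b, a))} := by
    ext ⟨⟨p, q⟩, ⟨r, s⟩⟩
    simp only [mem_filter, mem_product, mem_insert, mem_singleton, Prod.mk.injEq,
      finset_pair_eq_pair_iff]
    constructor
    · rintro ⟨-, ⟨⟨rfl, rfl⟩ | ⟨rfl, rfl⟩, ⟨rfl, rfl⟩ | ⟨rfl, rfl⟩⟩ |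
        ⟨⟨rfl, rfl⟩ | ⟨rfl, rfl⟩, ⟨rfl, rfl⟩ | ⟨rfl, rfl⟩⟩⟩ <;> simp
    · rintro (⟨⟨rfl, rfl⟩, rfl, rfl⟩ | ⟨⟨rfl, rfl⟩, rfl, rfl⟩ | ⟨⟨rfl, rfl⟩, rfl, rfl⟩ |
        ⟨⟨rfl, rfl⟩, rfl, rfl⟩ | ⟨⟨rfl, rfl⟩, rfl, rfl⟩ | ⟨⟨rfl, rfl⟩, rfl, rfl⟩ |
        ⟨⟨rfl, rfl⟩, rfl, rfl⟩ | ⟨⟨rfl, rfl⟩, rfl, rfl⟩)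
      · exact ⟨⟨⟨⟨ha, hb⟩, hc, hd⟩, h⟩, by simp⟩
      · exact ⟨⟨⟨⟨hb, ha⟩, hc, hd⟩, h.swap_left⟩, by simp⟩
      · exact ⟨⟨⟨⟨ha, hb⟩, hd, hc⟩, h.swap_right⟩, by simp⟩
      · exact ⟨⟨⟨⟨hb, ha⟩, hd, hc⟩, h.swap_left.swap_right⟩, by simp⟩
      · exact ⟨⟨⟨⟨hc, hd⟩, ha, hb⟩, h.symm⟩, by simp⟩
      · exact ⟨⟨⟨⟨hc, hd⟩, hb, ha⟩, h.symm.swap_right⟩, by simp⟩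
      · exact ⟨⟨⟨⟨hd, hc⟩, ha, hb⟩, h.symm.swap_left⟩, by simp⟩
      · exact ⟨⟨⟨⟨hd, hc⟩, hb, ha⟩, h.symm.swap_left.swap_right⟩, by simp⟩
  rw [this]
  simp [card_insert_of_notMem, hab, hac, had, hbc, hbd, hcd, hab.symm, hac.symm, had.symm,
    hbc.symm, hbd.symm, hcd.symm]

open Classical in
lemma GeneralPosition.eight_mul_crossingNumber {S : Finset Plane} (hS : GeneralPosition S) :
    8 * (crossingNumber S : ℤ) = quadSum S (fun p q r s => if Crosses p q r s then 1 else 0) := by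
  have hQ : quadSum S (fun p q r s => if Crosses p q r s then 1 else 0) =
      ((((S ×ˢ S) ×ˢ (S ×ˢ S)).filter fun x => Crosses x.1.1 x.1.2 x.2.1 x.2.2).card : ℤ) := by
    rw [card_filter, sum_product, sum_product, Nat.cast_sum, quadSum]
    refine sum_congr rfl fun p _ => ?_
    rw [Nat.cast_sum]
    refine sum_congr rfl fun q _ => ?_
    rw [sum_product]
    push_cast
    rfl
  rw [hQ, crossingNumber, card_eq_sum_card_fiberwise
    (s := ((S ×ˢ S) ×ˢ (S ×ˢ S)).filter fun x => Crosses x.1.1 x.1.2 x.2.1 x.2.2)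
    (f := fun x => ({{x.1.1, x.1.2}, {x.2.1, x.2.2}} : Finset (Finset Plane)))
    (t := ((S.powersetCard 2).powersetCard 2).filter fun P => ∃ a b c d : Plane,
      P = {{a, b}, {c, d}} ∧ (openSegment ℝ a b ∩ openSegment ℝ c d).Nonempty)]
  · rw [sum_congr rfl (g := fun _ => 8), sum_const, smul_eq_mul, Nat.cast_mul, mul_comm]
    · rfl
    intro P hP
    obtain ⟨hP, a, b, c, d, rfl, hne⟩ := mem_filter.1 hP
    obtain ⟨⟨ha, hb, hc, hd⟩, hX⟩ := hS.crosses_of_mem hP hne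
    exact hX.card_fiber ha hb hc hd
  · rintro ⟨⟨p, q⟩, ⟨r, s⟩⟩ hx
    simp only [coe_filter, mem_product, Set.mem_ofPred_eq] at hx
    obtain ⟨⟨⟨hp, hq⟩, hr, hs⟩, hX⟩ := hx
    simp only [coe_filter, Set.mem_ofPred_eq]
    exact ⟨hX.mem_powersetCard hp hq hr hs, p, q, r, s, rfl, hX.nonempty⟩

/-! ### Moments of the right counts -/

lemma sum_sum_ne {ι : Type*} [DecidableEq ι] (S : Finset ι) (f : ι → ℤ) :
    ∑ r ∈ S, ∑ s ∈ S, (if r = s then 0 else f r * f s) = (∑ r ∈ S, f r) ^ 2 - ∑ r ∈ S, f r ^ 2 := by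
  have : ∀ r ∈ S, ∑ s ∈ S, (if r = s then 0 else f r * f s) = f r * ∑ s ∈ S, f s - f r ^ 2 := by
    intro r hr
    rw [← add_sum_erase S f hr, ← add_sum_erase S _ hr, if_pos rfl]
    rw [sum_congr rfl fun s hs => if_neg (ne_of_mem_erase hs).symm, ← mul_sum]
    ring
  rw [sum_congr rfl this, sum_sub_distrib, ← sum_mul, sq]

open Classical in
/-- The number of points of `S` to the right of the line from `p` to `q`. -/
noncomputable def rightCount (S : Finset Plane) (pq : Plane × Plane) : ℕ :=
  (S.filter fun r => IsRightOf pq.1 pq.2 r).card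

open Classical in
lemma GeneralPosition.rightCount_facts {S : Finset Plane} (hS : GeneralPosition S)
    {pq : Plane × Plane} (h : pq ∈ S.offDiag) :
    (rightCount S pq + rightCount S pq.swap = S.card - 2) ∧ 
      (∑ r ∈ S, orient pq.1 pq.2 r = rightCount S pq.swap - rightCount S pq) ∧
      (∑ r ∈ S, orient pq.1 pq.2 r ^ 2 = (S.card : ℤ) - 2) := by
  obtain ⟨p, q⟩ := pq
  obtain ⟨hp, hq, hpq⟩ := mem_offDiag.1 h
  simp only at hp hq hpq
  have hsplit : S = insert p (insert q ((S.erase p).erase q)) := by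
    rw [insert_erase (mem_erase.2 ⟨hpq.symm, hq⟩), insert_erase hp]
  have hcard : ((S.erase p).erase q).card + 2 = S.card := by
    rw [card_erase_of_mem (mem_erase.2 ⟨hpq.symm, hq⟩), card_erase_of_mem hp]
    have : ({p, q} : Finset Plane).card ≤ S.card :=
      card_le_card (by intro x; simp only [mem_insert, mem_singleton]; rintro (rfl | rfl) <;> assumption)
    rw [card_pair hpq] at this
    omega
  have hsum : ∀ f : Plane → ℤ, f p = 0 → f q = 0 →
      ∑ r ∈ S, f r = ∑ r ∈ (S.erase p).erase q, f r := by
    intro f h1 h2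
    rw [← add_sum_erase S f hp, ← add_sum_erase _ f (mem_erase.2 ⟨hpq.symm, hq⟩), h1, h2]; ring
  have hne : ∀ r ∈ (S.erase p).erase q, det p q r ≠ 0 := by
    intro r hr
    simp only [mem_erase] at hr
    exact hS.det_ne_zero hp hq hr.2.2 hpq hr.2.1.symm hr.1.symm
  have hR : (rightCount S (p, q) : ℤ) =
      ∑ r ∈ (S.erase p).erase q, if det p q r < 0 then 1 else 0 := by
    rw [rightCount, card_filter, Nat.cast_sum]
    simp only [isRightOf_iff, Nat.cast_ite, Nat.cast_one, Nat.cast_zero]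
    exact hsum _ (by simp [det_self_outer]) (by simp [det_self_right])
  have hL : (rightCount S (q, p) : ℤ) =
      ∑ r ∈ (S.erase p).erase q, if 0 < det p q r then 1 else 0 := by
    rw [rightCount, card_filter, Nat.cast_sum]
    simp only [isRightOf_iff, Nat.cast_ite, Nat.cast_one, Nat.cast_zero, det_swap_left p q,
      neg_lt_zero]
    exact hsum _ (by simp [det_self_outer]) (by simp [det_self_right])
  have hA : (rightCount S (p, q) : ℤ) + rightCount S (q, p) = ((S.erase p).erase q).card := by
    rw [hR, hL, ← sum_add_distrib, card_eq_sum_ones, Nat.cast_sum]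
    refine sum_congr rfl fun r hr => ?_
    rcases (hne r hr).lt_or_gt with h | h <;> simp [h, h.not_gt]
  refine ⟨?_, ?_, ?_⟩
  · simp only [Prod.swap_prod_mk]; omega
  · simp only [Prod.swap_prod_mk]
    rw [hR, hL, ← sum_sub_distrib, hsum _ (orient_self_outer p q) (orient_self_right p q)]
    refine sum_congr rfl fun r hr => ?_
    rcases (hne r hr).lt_or_gt with h | h <;>
      simp [h, h.not_gt, orient_of_neg, orient_of_pos]
  · rw [hsum _ (by simp [orient_self_outer p q]) (by simp [orient_self_right p q]),
      show (S.card : ℤ) - 2 = ((S.erase p).erase q).card by omega, card_eq_sum_ones, Nat.cast_sum]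
    refine sum_congr rfl fun r hr => ?_
    rcases (hne r hr).lt_or_gt with h | h <;> simp [h, orient_of_neg, orient_of_pos]

-- For each pair, the sum of `sidePair` over `r`, `s` is the squared difference of the two sides
-- minus the diagonal `n-2`; the diagonal over all `n(n-1)` pairs gives the last term.
open Classical in
lemma GeneralPosition.sum_sq_sub {S : Finset Plane} (hS : GeneralPosition S) :
    ∑ pq ∈ S.offDiag, ((rightCount S pq.swap : ℤ) - rightCount S pq) ^ 2 =
      8 * (crossingNumber S : ℤ) + S.card * (S.card - 1) * (S.card - 2) := by
  rw [hS.eight_mul_crossingNumber, hS.quadSum_crosses, quadSum]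
  simp only [sidePair, sum_sum_ne S]
  have h0 : ∀ p ∈ S, ∑ q ∈ S, ((∑ r ∈ S, orient p q r) ^ 2 - ∑ r ∈ S, orient p q r ^ 2) =
      ∑ q ∈ S.erase p, ((∑ r ∈ S, orient p q r) ^ 2 - ∑ r ∈ S, orient p q r ^ 2) := by
    intro p hp
    rw [← add_sum_erase S _ hp]
    simp [orient_self_left]
  have h1 : ∑ p ∈ S, ∑ q ∈ S, ((∑ r ∈ S, orient p q r) ^ 2 - ∑ r ∈ S, orient p q r ^ 2) =
      ∑ pq ∈ S.offDiag, (((rightCount S pq.swap : ℤ) - rightCount S pq) ^ 2 - (S.card - 2)) := by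
    rw [← sum_product', ← diag_union_offDiag, sum_union (disjoint_diag_offDiag _)]
    rw [sum_eq_zero (s := S.diag), zero_add]
    · refine sum_congr rfl fun pq h => ?_
      rw [(hS.rightCount_facts h).2.1, (hS.rightCount_facts h).2.2]
    · rintro ⟨p, q⟩ h
      obtain ⟨-, rfl⟩ : p ∈ S ∧ p = q := by simpa using h
      simp [orient_self_left]
  rw [h1, sum_sub_distrib, sum_const, offDiag_card, nsmul_eq_mul, Nat.cast_sub (Nat.le_mul_self _)]
  push_cast
  ring

lemma sum_offDiag_swap {M : Type*} [AddCommMonoid M] (S : Finset Plane)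
    [DecidableEq Plane] (f : Plane × Plane → M) :
    ∑ pq ∈ S.offDiag, f pq.swap = ∑ pq ∈ S.offDiag, f pq := by
  refine sum_nbij' Prod.swap Prod.swap ?_ ?_ ?_ ?_ ?_
  · rintro ⟨p, q⟩ h
    rw [mem_offDiag] at h ⊢
    exact ⟨h.2.1, h.1, h.2.2.symm⟩
  · rintro ⟨p, q⟩ h
    rw [mem_offDiag] at h ⊢
    exact ⟨h.2.1, h.1, h.2.2.symm⟩
  all_goals simp

open Classical in
lemma GeneralPosition.sum_comp_sub {S : Finset Plane} (hS : GeneralPosition S) (hn : 2 ≤ S.card)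
    (f : ℂ → ℂ) :
    ∑ pq ∈ S.offDiag, f ((S.card - 2 : ℂ) - rightCount S pq) =
      ∑ pq ∈ S.offDiag, f (rightCount S pq) := by
  rw [← sum_offDiag_swap S fun pq => f (rightCount S pq)]
  refine sum_congr rfl fun pq h => ?_
  have := (hS.rightCount_facts h).1
  have h2 : ((rightCount S pq + rightCount S pq.swap + 2 : ℕ) : ℂ) = S.card := by
    congr 1; omega
  push_cast at h2
  rw [← h2]
  congr 1; ring

open Classical in
lemma card_offDiag_cast (S : Finset Plane) :
    ((S.offDiag).card : ℂ) = S.card * (S.card - 1) := by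
  rw [offDiag_card, Nat.cast_sub (Nat.le_mul_self _)]; push_cast; ring

open Classical in
/-- The first three moments of the number of points to the right of a directed line. -/
lemma GeneralPosition.moments {S : Finset Plane} (hS : GeneralPosition S) (hn : 2 ≤ S.card) :
    (∑ pq ∈ S.offDiag, (rightCount S pq : ℂ) = S.card * (S.card - 1) * (S.card - 2) / 2) ∧
    (∑ pq ∈ S.offDiag, (rightCount S pq : ℂ) ^ 2 = 2 * crossingNumber S +
      S.card * (S.card - 1) * (S.card - 2) * (S.card - 1) / 4) ∧
    (∑ pq ∈ S.offDiag, (rightCount S pq : ℂ) ^ 3 = (S.card - 2) *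
      (3 * crossingNumber S + S.card * (S.card - 1) * (S.card - 2) / 8 * (S.card + 1))) := by
  have h0 := card_offDiag_cast S
  have h1 := hS.sum_comp_sub hn fun z => z
  -- Reversal flips the sign of an odd leading term, so `z` and `z ^ 3` determine `M1` and `M3`;
  -- `M2` has to come from `sum_sq_sub`.
  have h3 := hS.sum_comp_sub hn fun z => z ^ 3
  have h2 : ∑ pq ∈ S.offDiag, ((S.card - 2 : ℂ) - 2 * rightCount S pq) ^ 2 =
      8 * (crossingNumber S : ℂ) + S.card * (S.card - 1) * (S.card - 2) := by
    have := congrArg (Int.cast (R := ℂ)) hS.sum_sq_sub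
    push_cast at this
    rw [← this]
    refine sum_congr rfl fun pq h => ?_
    have := (hS.rightCount_facts h).1
    have h2 : ((rightCount S pq + rightCount S pq.swap + 2 : ℕ) : ℂ) = S.card := by
      congr 1; omega
    push_cast at h2
    rw [← h2]
    ring
  have e2 : ∀ x : ℂ, ((S.card - 2 : ℂ) - 2 * x) ^ 2 =
      (S.card - 2 : ℂ) ^ 2 - 4 * (S.card - 2) * x + 4 * x ^ 2 := fun x => by ring
  have e3 : ∀ x : ℂ, ((S.card - 2 : ℂ) - x) ^ 3 = (S.card - 2 : ℂ) ^ 3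
      - 3 * (S.card - 2) ^ 2 * x + 3 * (S.card - 2) * x ^ 2 - x ^ 3 := fun x => by ring
  simp only [e2, e3, sum_add_distrib, sum_sub_distrib, ← mul_sum, sum_const, nsmul_eq_mul, h0]
    at h1 h2 h3
  set M1 := ∑ pq ∈ S.offDiag, (rightCount S pq : ℂ)
  set M2 := ∑ pq ∈ S.offDiag, (rightCount S pq : ℂ) ^ 2
  set M3 := ∑ pq ∈ S.offDiag, (rightCount S pq : ℂ) ^ 3
  have hM1 : M1 = S.card * (S.card - 1) * (S.card - 2) / 2 := by linear_combination -h1 / 2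
  have hM2 : M2 = 2 * crossingNumber S +
      S.card * (S.card - 1) * (S.card - 2) * (S.card - 1) / 4 := by
    linear_combination h2 / 4 + (S.card - 2 : ℂ) * hM1
  refine ⟨hM1, hM2, ?_⟩
  linear_combination -h3 / 2 - 3 / 2 * (S.card - 2 : ℂ) ^ 2 * hM1 + 3 / 2 * (S.card - 2 : ℂ) * hM2

/-! ### From the polynomial to sums over ordered pairs -/

open Classical in
lemma numAtMostEdges_eq (S : Finset Plane) (k : ℕ) :
    numAtMostEdges S k = ∑ pq ∈ S.offDiag, if rightCount S pq ≤ k then 1 else 0 := by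
  simp only [numAtMostEdges, numEdges, card_filter]
  rw [sum_comm]
  refine sum_congr rfl fun pq _ => ?_
  rw [sum_ite_eq]
  simp only [mem_range, Nat.lt_succ_iff, rightCount, card_filter]

open Classical in
lemma GeneralPosition.sum_numAtMostEdges_mul {S : Finset Plane} (hS : GeneralPosition S)
    (w W : ℕ → ℂ) (hW : ∀ i, W i = ∑ k ∈ range i, w k) :
    ∑ k ∈ range (S.card - 2), (numAtMostEdges S k : ℂ) * w k =
      ∑ pq ∈ S.offDiag, (W (S.card - 2) - W (rightCount S pq)) := by
  simp only [numAtMostEdges_eq, Nat.cast_sum, Nat.cast_ite, Nat.cast_one, Nat.cast_zero, sum_mul]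
  rw [sum_comm]
  refine sum_congr rfl fun pq h => ?_
  have hle : rightCount S pq ≤ S.card - 2 := by
    have := (hS.rightCount_facts h).1; omega
  -- The pair is counted for `k` from `rightCount S pq` to `n-3`, an empty range when all other
  -- points lie on its right.
  rw [hW, hW, ← sum_Ico_eq_sub _ hle]
  simp only [ite_mul, one_mul, zero_mul]
  rw [← sum_filter]
  refine sum_congr ?_ fun _ _ => rfl
  ext k; simp [and_comm]

lemma eval_edgePolynomial (S : Finset Plane) (z : ℂ) : (edgePolynomial S).eval z =
    ∑ k ∈ range (S.card - 2), (numAtMostEdges S k : ℂ) * z ^ k := by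
  simp [edgePolynomial, Polynomial.eval_finsetSum]

lemma eval_one_derivative_edgePolynomial (S : Finset Plane) :
    (Polynomial.derivative (edgePolynomial S)).eval 1 =
      ∑ k ∈ range (S.card - 2), (numAtMostEdges S k : ℂ) * k := by
  simp [edgePolynomial, Polynomial.eval_finsetSum, Polynomial.derivative_X_pow]

lemma eval_one_derivative_derivative_edgePolynomial (S : Finset Plane) :
    (Polynomial.derivative (Polynomial.derivative (edgePolynomial S))).eval 1 =
      ∑ k ∈ range (S.card - 2), (numAtMostEdges S k : ℂ) * (k * (k - 1)) := by
  simp only [edgePolynomial, Polynomial.eval_finsetSum, Polynomial.derivative_sum]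
  refine sum_congr rfl fun k _ => ?_
  -- Separating `k = 0` avoids the truncated exponent `k - 1`.
  rcases k with _ | k <;> simp [Polynomial.derivative_X_pow]

/-! ### Binomial coefficients and the four evaluations -/

lemma cast_choose_three (n : ℕ) : (n.choose 3 : ℂ) = n * (n - 1) * (n - 2) / 6 := by
  induction n with
  | zero => simp
  | succ n ih =>
    rw [Nat.choose_succ_succ' n 2, Nat.cast_add, ih, Nat.cast_choose_two]; push_cast; ring

lemma cast_choose_four (n : ℕ) : (n.choose 4 : ℂ) = n * (n - 1) * (n - 2) * (n - 3) / 24 := by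
  induction n with
  | zero => simp
  | succ n ih =>
    rw [Nat.choose_succ_succ' n 3, Nat.cast_add, ih, cast_choose_three]; push_cast; ring

lemma cast_choose_five (n : ℕ) :
    (n.choose 5 : ℂ) = n * (n - 1) * (n - 2) * (n - 3) * (n - 4) / 120 := by
  induction n with
  | zero => simp
  | succ n ih =>
    rw [Nat.choose_succ_succ' n 4, Nat.cast_add, ih, cast_choose_four]; push_cast; ring

lemma crossingNumber_of_card_lt {S : Finset Plane} (h : S.card < 2) : crossingNumber S = 0 := by
  have : S.powersetCard 2 = ∅ := powersetCard_eq_empty.2 h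
  rw [crossingNumber, this]
  simp

open Classical in
lemma GeneralPosition.eval_one {S : Finset Plane} (hS : GeneralPosition S) (hn : 2 ≤ S.card) :
    (edgePolynomial S).eval 1 = 3 * (S.card.choose 3 : ℂ) := by
  obtain ⟨h1, -⟩ := hS.moments hn
  simp only [eval_edgePolynomial, one_pow]
  rw [hS.sum_numAtMostEdges_mul (fun _ => 1) (fun i => i) (by simp)]
  rw [sum_sub_distrib, sum_const, nsmul_eq_mul, h1, card_offDiag_cast, Nat.cast_sub hn,
    cast_choose_three]
  push_cast
  ring

open Classical in
lemma GeneralPosition.eval_one_derivative {S : Finset Plane} (hS : GeneralPosition S)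
    (hn : 2 ≤ S.card) : (Polynomial.derivative (edgePolynomial S)).eval 1 =
      9 * (S.card.choose 4 : ℂ) - crossingNumber S := by
  obtain ⟨h1, h2, -⟩ := hS.moments hn
  have hW : ∀ i : ℕ, (1 / 2 : ℂ) * (i : ℂ) ^ 2 - 1 / 2 * i = ∑ k ∈ range i, (k : ℂ) := by
    intro i
    induction i with
    | zero => simp
    | succ i ih => rw [sum_range_succ, ← ih]; push_cast; ring
  rw [eval_one_derivative_edgePolynomial, hS.sum_numAtMostEdges_mul _ _ hW]
  simp only [sum_sub_distrib, sum_const, nsmul_eq_mul, ← mul_sum, h1, h2, card_offDiag_cast,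
    Nat.cast_sub hn, cast_choose_four]
  push_cast
  ring

open Classical in
lemma GeneralPosition.eval_one_derivative_derivative {S : Finset Plane} (hS : GeneralPosition S)
    (hn : 2 ≤ S.card) :
    (Polynomial.derivative (Polynomial.derivative (edgePolynomial S))).eval 1 =
      35 * (S.card.choose 5 : ℂ) - ((S.card : ℂ) - 4) * crossingNumber S := by
  obtain ⟨h1, h2, h3⟩ := hS.moments hn
  -- This is `i(i-1)(i-2)/3`, expanded into monomials so that the moments can be substituted.
  have hW : ∀ i : ℕ, (1 / 3 : ℂ) * (i : ℂ) ^ 3 - (i : ℂ) ^ 2 + 2 / 3 * i =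
      ∑ k ∈ range i, (k : ℂ) * (k - 1) := by
    intro i
    induction i with
    | zero => simp
    | succ i ih => rw [sum_range_succ, ← ih]; push_cast; ring
  rw [eval_one_derivative_derivative_edgePolynomial, hS.sum_numAtMostEdges_mul _ _ hW]
  simp only [sum_sub_distrib, sum_add_distrib, sum_const, nsmul_eq_mul, ← mul_sum, h1, h2, h3,
    card_offDiag_cast, Nat.cast_sub hn, cast_choose_five]
  push_cast
  ring

open Classical in
lemma GeneralPosition.eval_neg_one {S : Finset Plane} (hS : GeneralPosition S) (hn : 2 ≤ S.card)
    (hodd : Odd S.card) :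
    (edgePolynomial S).eval (-1) = (S.card : ℂ) * ((S.card : ℂ) - 1) / 2 := by
  have hm : Odd (S.card - 2) := (Nat.odd_sub hn).2 (by simp [hodd])
  have hW : ∀ i : ℕ, (1 / 2 : ℂ) - 1 / 2 * (-1) ^ i = ∑ k ∈ range i, (-1 : ℂ) ^ k := by
    intro i
    induction i with
    | zero => simp
    | succ i ih => rw [sum_range_succ, ← ih]; ring
  -- Since `n-2` is odd, the counts of a line and of its reversal have opposite parity.
  have hzero : ∑ pq ∈ S.offDiag, (-1 : ℂ) ^ rightCount S pq = 0 := by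
    have h := sum_offDiag_swap S fun pq => (-1 : ℂ) ^ rightCount S pq
    have h' : ∑ pq ∈ S.offDiag, (-1 : ℂ) ^ rightCount S pq.swap =
        ∑ pq ∈ S.offDiag, -(-1 : ℂ) ^ rightCount S pq := by
      refine sum_congr rfl fun pq hpq => ?_
      have hj := (hS.rightCount_facts hpq).1
      rw [← hj] at hm
      have h1 := hm.neg_one_pow (α := ℂ)
      rw [pow_add] at h1
      rcases neg_one_pow_eq_or ℂ (rightCount S pq) with h2 | h2 <;> rw [h2] at h1 ⊢ <;>
        first
        | linear_combination h1
        | linear_combination -h1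
    rw [h', sum_neg_distrib] at h
    linear_combination -h / 2
  rw [eval_edgePolynomial, hS.sum_numAtMostEdges_mul _ _ hW]
  simp only [sum_sub_distrib, sum_const, nsmul_eq_mul, ← mul_sum, hzero, card_offDiag_cast,
    hm.neg_one_pow]
  ring

end EdgePoly

theorem mainTheorem9 (S : Finset EdgePoly.Plane) (n : ℕ) (hn : S.card = n)
    (hS : EdgePoly.GeneralPosition S) :
    (EdgePoly.edgePolynomial S).eval 1 = 3 * (n.choose 3 : ℂ) ∧
    (Polynomial.derivative (EdgePoly.edgePolynomial S)).eval 1 =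
      9 * (n.choose 4 : ℂ) - (EdgePoly.crossingNumber S : ℂ) ∧
    (Polynomial.derivative (Polynomial.derivative (EdgePoly.edgePolynomial S))).eval 1 =
      35 * (n.choose 5 : ℂ) - ((n : ℂ) - 4) * (EdgePoly.crossingNumber S : ℂ) ∧
    (Odd n → (EdgePoly.edgePolynomial S).eval (-1) = (n : ℂ) * ((n : ℂ) - 1) / 2) := by
  subst hn
  rcases lt_or_ge S.card 2 with hn | hn
  -- For `n < 2` truncated subtraction makes the range of summation empty.
  · have h0 : EdgePoly.edgePolynomial S = 0 := by
      simp [EdgePoly.edgePolynomial, Nat.sub_eq_zero_of_le hn.le]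
    rw [h0, EdgePoly.crossingNumber_of_card_lt hn, Nat.choose_eq_zero_of_lt (by omega),
      Nat.choose_eq_zero_of_lt (by omega), Nat.choose_eq_zero_of_lt (by omega)]
    interval_cases S.card <;> simp
  · exact ⟨hS.eval_one hn, hS.eval_one_derivative hn, hS.eval_one_derivative_derivative hn,
      hS.eval_neg_one hn⟩
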